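/- For integers $k,t,q,p\ge 1$ let $r_k(t;q,p)$ be the smallest integer $n$ such that every colouring with $q$ colours of the $k$-element subsets of an $n$-element set admits a set of $t$ vertices whose $k$-element subsets receive fewer than $p$ distinct colours in total. (Such an $n$ exists for every $p\ge 2$, by Ramsey's theorem.) Let $C_k=\frac{1}{k+1}\binom{2k}{k}$ be the $k$-th Catalan number. Theorem. Let $k,q,p\ge 3$ be integers with $p\le C_k$. There exist integers $c\ge 1$ and $t_0$ (depending on $k,q,p$) such that for all integers $t>t_0$: (1) if $p\ge 4$ and $q\ge p-2$, then $r_{k+1}(t^c;\,q,\,p-2) > 2^{\,r_k(t;\,q,\,p-2)-1}$; (2) $r_{k+1}(t^c;\,2q+p,\,p) > 2^{\,r_k(t;\,q,\,p)-1}$. -/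

import Mathlib

/-- The set of colours that appear on the `k`-element subsets of the vertex set `T`, under a
colouring `χ` with `q` colours of the edges of the complete `k`-uniform hypergraph on `Fin n`. -/
def spannedColours {n k q : ℕ} (χ : {e : Finset (Fin n) // e.card = k} → Fin q)
    (T : Finset (Fin n)) : Finset (Fin q) :=
  (Finset.univ.filter (fun e : {e : Finset (Fin n) // e.card = k} => e.1 ⊆ T)).image χ

/-- In every colouring with `q` colours of the `k`-element subsets of an `n`-element set there are
`t` vertices that span fewer than `p` colours. -/
def ForcesFewColours (k t q p n : ℕ) : Prop :=
  ∀ χ : {e : Finset (Fin n) // e.card = k} → Fin q,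
    ∃ T : Finset (Fin n), T.card = t ∧ (spannedColours χ T).card < p

/-- The generalized Ramsey number `r_k(t; q, p)`: the smallest `n` such that every colouring with
`q` colours of the `k`-element subsets of an `n`-element set contains `t` vertices that span fewer
than `p` colours. By Ramsey's theorem such an `n` exists whenever `q ≥ 1` and `p ≥ 2`. -/
noncomputable def ramseyNumber (k t q p : ℕ) : ℕ :=
  sInf {n : ℕ | ForcesFewColours k t q p n}

open Finset BinaryTree

/-! This is a stepping-up argument. Put `n = r_k - 1`, fix a colouring `χ` of the `k`-subsets of the
`n` bit positions witnessing `n < r_k`, and take the numbers below `2 ^ n` as vertices. The binary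
digits of a `(k+1)`-set form a binary tree with `k` branchings, so one of `C_k` shapes. In a comb
the branchings sit at `k` distinct levels, and `stepUp` gives the set the `χ`-colour of these
levels; any other set is coloured by its shape.

By `exists_comb_or_hasAllShapes`, more than `(2t) ^ k` vertices contain either a comb on `t` levels,
all of whose `k`-subsets of levels are realised, so that `χ` already supplies enough colours, or
every tree with `k` branchings. In the latter case the non-combs give at least `C_k - 2` colours,
which suffices for (1). For (2) left combs, right combs and the other shapes get disjoint palettes,
and the two kinds of comb add the two missing colours.

Since `sInf ∅ = 0`, a lower bound on a Ramsey number also needs Ramsey's theorem, to exclude the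
empty set. -/

/-! ### Ramsey's theorem -/

/-- Greedy choice of minima: apply Ramsey for `k`-sets to the link of the least vertex, then recurse
inside the homogeneous set found. The colour of a `(k+1)`-set then depends only on its minimum. -/
theorem exists_prehomogeneous {k q : ℕ}
    (ramsey : ∀ t : ℕ, ∃ N : ℕ, ∀ S : Finset ℕ, N ≤ S.card → ∀ χ : Finset ℕ → ℕ,
      (∀ e, χ e < q) → ∃ T ⊆ S, T.card = t ∧ ∃ c, ∀ e ∈ powersetCard k T, χ e = c) (m : ℕ) :
    ∃ N : ℕ, ∀ S : Finset ℕ, N ≤ S.card → ∀ χ : Finset ℕ → ℕ, (∀ e, χ e < q) →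
      ∃ T ⊆ S, T.card = m ∧ ∀ x ∈ T, ∃ c, ∀ e ∈ powersetCard k T,
        (∀ y ∈ e, x < y) → χ (insert x e) = c := by
  induction m with
  | zero => exact ⟨0, fun S _ χ _ => ⟨∅, by simp, by simp, by simp⟩⟩
  | succ m ih =>
    obtain ⟨N, hN⟩ := ih
    obtain ⟨M, hM⟩ := ramsey N
    refine ⟨M + 1, fun S hS χ hχ => ?_⟩
    have hne : S.Nonempty := card_pos.1 (by omega)
    have hmin : ∀ y ∈ S.erase (S.min' hne), S.min' hne < y := fun y hy =>
      S.min'_lt_of_mem_erase_min' hne hy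
    set x := S.min' hne with hx
    have hxS : x ∈ S := S.min'_mem hne
    obtain ⟨U, hUS, hU, c, hc⟩ := hM (S.erase x) (by rw [card_erase_of_mem hxS]; omega)
      (fun e => χ (insert x e)) (fun e => hχ _)
    obtain ⟨T, hTU, hT, hpre⟩ := hN U hU.ge χ hχ
    have hlt : ∀ y ∈ T, x < y := fun y hy => hmin y (hUS (hTU hy))
    have hxT : x ∉ T := fun h => lt_irrefl _ (hlt x h)
    refine ⟨insert x T, insert_subset hxS fun y hy => mem_of_mem_erase (hUS (hTU hy)),
      by rw [card_insert_of_notMem hxT, hT], ?_⟩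
    have key : ∀ z ∈ insert x T, ∀ e ∈ powersetCard k (insert x T), (∀ y ∈ e, z < y) →
        e ∈ powersetCard k T := by
      intro z hz e he hlt'
      rw [mem_powersetCard] at he ⊢
      refine ⟨fun y hy => ?_, he.2⟩
      rcases mem_insert.1 (he.1 hy) with rfl | h
      · rcases mem_insert.1 hz with rfl | h
        · exact absurd (hlt' _ hy) (lt_irrefl _)
        · exact absurd (hlt' _ hy) (hlt _ h).not_gt
      · exact h
    intro z hz
    rcases mem_insert.1 hz with rfl | hzT
    · exact ⟨c, fun e he hl => hc e (powersetCard_mono hTU (key _ hz e he hl))⟩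
    · obtain ⟨c', hc'⟩ := hpre z hzT
      exact ⟨c', fun e he hl => hc' e (key _ hz e he hl) hl⟩

/-- The finite Ramsey theorem for `k`-uniform hypergraphs. -/
theorem exists_homogeneous (k : ℕ) {q : ℕ} (hq : 0 < q) :
    ∀ t : ℕ, ∃ N : ℕ, ∀ S : Finset ℕ, N ≤ S.card → ∀ χ : Finset ℕ → ℕ,
      (∀ e, χ e < q) → ∃ T ⊆ S, T.card = t ∧ ∃ c, ∀ e ∈ powersetCard k T, χ e = c := by
  induction k with
  | zero =>
    refine fun t => ⟨t, fun S hS χ _ => ?_⟩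
    obtain ⟨T, hT, hTt⟩ := exists_subset_card_eq hS
    exact ⟨T, hT, hTt, χ ∅, by simp⟩
  | succ k ih =>
    intro t
    obtain ⟨N, hN⟩ := exists_prehomogeneous ih (q * t)
    refine ⟨N, fun S hS χ hχ => ?_⟩
    obtain ⟨U, hUS, hU, hpre⟩ := hN S hS χ hχ
    choose! g hg using hpre
    -- `g x` is arbitrary when no `k`-set of `U` lies above `x`; truncating it gives a genuine
    -- colour for the pigeonhole.
    have hmaps : ∀ x ∈ U, min (g x) (q - 1) ∈ range q := fun x _ => by
      rw [mem_range]; omega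
    obtain ⟨c, -, hc⟩ := exists_le_card_fiber_of_mul_le_card_of_maps_to hmaps
      (by simpa using hq.ne') (by simp [hU] : (range q).card * t ≤ U.card)
    obtain ⟨T, hTsub, hT⟩ := exists_subset_card_eq hc
    have hTU : T ⊆ U := fun x hx => (mem_filter.1 (hTsub hx)).1
    refine ⟨T, hTU.trans hUS, hT, c, fun e he => ?_⟩
    rw [mem_powersetCard] at he
    have hne : e.Nonempty := card_pos.1 (by omega)
    have hxe := e.min'_mem hne
    have hxT := he.1 hxe
    have hcol := hg _ (hTU hxT) (e.erase (e.min' hne))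
      (mem_powersetCard.2 ⟨fun y hy => hTU (he.1 (mem_of_mem_erase hy)),
        by rw [card_erase_of_mem hxe]; omega⟩)
      (fun y hy => e.min'_lt_of_mem_erase_min' hne hy)
    rw [insert_erase hxe] at hcol
    have h1 := (mem_filter.1 (hTsub hxT)).2
    have h2 := hχ e
    omega

/-! ### Ramsey numbers through colourings of `Finset ℕ` -/

theorem forcesFewColours_iff {k t q p n : ℕ} (hq : 0 < q) :
    ForcesFewColours k t q p n ↔ ∀ χ : Finset ℕ → ℕ, (∀ e, χ e < q) →
      ∃ T ⊆ range n, T.card = t ∧ ((powersetCard k T).image χ).card < p := by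
  constructor
  · intro h χ hχ
    obtain ⟨T, hT, hc⟩ := h fun e => ⟨χ (e.1.map Fin.valEmbedding), hχ _⟩
    refine ⟨T.map Fin.valEmbedding, fun x hx => ?_, by simpa using hT, lt_of_le_of_lt ?_ hc⟩
    · obtain ⟨y, -, rfl⟩ := mem_map.1 hx
      simp
    · rw [← card_map Fin.valEmbedding]
      refine card_le_card fun c hcol => ?_
      obtain ⟨e, he, rfl⟩ := mem_image.1 hcol
      obtain ⟨heT, hek⟩ := mem_powersetCard.1 he
      obtain ⟨e', he', rfl⟩ := subset_map_iff.1 heT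
      rw [card_map] at hek
      refine mem_map.2 ⟨_, mem_image.2 ⟨⟨e', hek⟩, ?_, rfl⟩, rfl⟩
      simpa using he'
  · intro h χ
    have hinj : ∀ e : Finset (Fin n),
        (univ.filter fun i : Fin n => (i : ℕ) ∈ e.map Fin.valEmbedding) = e := by
      intro e; ext i; simp [Fin.val_inj]
    obtain ⟨T, hTn, hT, hc⟩ := h (fun e =>
        if he : (univ.filter fun i : Fin n => (i : ℕ) ∈ e).card = k then (χ ⟨_, he⟩ : ℕ) else 0)
      (fun e => by split_ifs <;> simp [hq])
    have hTm : (univ.filter fun i : Fin n => (i : ℕ) ∈ T).map Fin.valEmbedding = T := by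
      ext x
      simp only [mem_map, mem_filter, mem_univ, true_and, Fin.valEmbedding_apply]
      exact ⟨by rintro ⟨y, hy, rfl⟩; exact hy, fun hx => ⟨⟨x, mem_range.1 (hTn hx)⟩, hx, rfl⟩⟩
    refine ⟨univ.filter fun i : Fin n => (i : ℕ) ∈ T, ?_, lt_of_le_of_lt ?_ hc⟩
    · rw [← card_map Fin.valEmbedding, hTm, hT]
    · rw [← card_map Fin.valEmbedding]
      refine card_le_card fun c hcol => ?_
      obtain ⟨c', hcol', rfl⟩ := mem_map.1 hcol
      obtain ⟨⟨e, hek⟩, he, rfl⟩ := mem_image.1 hcol'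
      refine mem_image.2 ⟨e.map Fin.valEmbedding, mem_powersetCard.2 ⟨?_, by simpa using hek⟩, ?_⟩
      · rw [← hTm]; exact map_subset_map.2 (mem_filter.1 he).2
      · simp only [hinj, hek, dif_pos, Fin.valEmbedding_apply]

theorem forcesFewColours_ramseyNumber {k t q p : ℕ} (hq : 0 < q) (hp : 2 ≤ p) :
    ForcesFewColours k t q p (ramseyNumber k t q p) := by
  obtain ⟨N, hN⟩ := exists_homogeneous k hq t
  refine Nat.sInf_mem (s := {n | ForcesFewColours k t q p n})
    ⟨N, (forcesFewColours_iff hq).2 fun χ hχ => ?_⟩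
  obtain ⟨T, hTS, hT, c, hc⟩ := hN (range N) (by simp) χ hχ
  refine ⟨T, hTS, hT, lt_of_le_of_lt (card_le_card (t := {c}) fun x hx => ?_) hp⟩
  obtain ⟨e, he, rfl⟩ := mem_image.1 hx
  simp [hc e he]

theorem exists_colouring_of_lt_ramseyNumber {k t q p n : ℕ} (hq : 0 < q)
    (hn : n < ramseyNumber k t q p) :
    ∃ χ : Finset ℕ → ℕ, (∀ e, χ e < q) ∧ ∀ T ⊆ range n, T.card = t →
      p ≤ ((powersetCard k T).image χ).card := by
  have h : ¬ ForcesFewColours k t q p n := Nat.notMem_of_lt_sInf hn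
  rw [forcesFewColours_iff hq] at h
  push Not at h
  exact h

theorem lt_ramseyNumber_of_colouring {k t q p n : ℕ} (hq : 0 < q) (hp : 2 ≤ p)
    (χ : Finset ℕ → ℕ) (hχ : ∀ e, χ e < q)
    (h : ∀ T ⊆ range n, T.card = t → p ≤ ((powersetCard k T).image χ).card) :
    n < ramseyNumber k t q p := by
  by_contra! hle
  obtain ⟨T, hT, hTt, hc⟩ :=
    (forcesFewColours_iff hq).1 (forcesFewColours_ramseyNumber (k := k) (t := t) hq hp) χ hχ
  exact hc.not_ge (h T (hT.trans (range_subset_range.2 hle)) hTt)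

/-! ### Branching trees of binary expansions -/

/-- The elements of `S` whose `n`-th binary digit is `b`. -/
def bitHalf (n : ℕ) (b : Bool) (S : Finset ℕ) : Finset ℕ :=
  S.filter fun x => x.testBit n = b

/-- The shape of the binary tree formed by the lowest `n` binary digits of the elements of `S`,
with unary branchings suppressed. -/
def branchShape : ℕ → Finset ℕ → BinaryTree Unit
  | 0, _ => nil
  | n + 1, S =>
    if bitHalf n false S = ∅ ∨ bitHalf n true S = ∅ then branchShape n S
    else node () (branchShape n (bitHalf n false S)) (branchShape n (bitHalf n true S))

/-- The positions at which the binary tree formed by the lowest `n` binary digits of the elements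
of `S` branches. -/
def branchLevels : ℕ → Finset ℕ → Finset ℕ
  | 0, _ => ∅
  | n + 1, S =>
    if bitHalf n false S = ∅ ∨ bitHalf n true S = ∅ then branchLevels n S
    else insert n (branchLevels n (bitHalf n false S) ∪ branchLevels n (bitHalf n true S))

/-- The binary tree whose internal nodes form a path that always descends to the left (`false`) or
always descends to the right (`true`). -/
def combTree (b : Bool) : ℕ → BinaryTree Unit
  | 0 => nil
  | k + 1 => if b then node () nil (combTree b k) else node () (combTree b k) nil

/-- Every set of levels inside `L` is the set of branching levels of a comb spanned by `S`. -/
def HasComb (b : Bool) (n : ℕ) (S L : Finset ℕ) : Prop :=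
  ∀ K ⊆ L, ∃ e ⊆ S, e.card = K.card + 1 ∧ branchShape n e = combTree b K.card ∧
    branchLevels n e = K

/-- Every binary tree of height at most `d` is the shape of a subset of `S`. -/
def HasAllShapes (n d : ℕ) (S : Finset ℕ) : Prop :=
  ∀ τ : BinaryTree Unit, τ.height ≤ d → ∃ e ⊆ S, e.card = τ.numNodes + 1 ∧ branchShape n e = τ

theorem bitHalf_subset (n : ℕ) (b : Bool) (S : Finset ℕ) : bitHalf n b S ⊆ S :=
  filter_subset _ _

theorem card_bitHalf_add (n : ℕ) (b : Bool) (S : Finset ℕ) :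
    (bitHalf n b S).card + (bitHalf n (!b) S).card = S.card := by
  rw [← card_filter_add_card_filter_not (s := S) fun x => x.testBit n = b, bitHalf, bitHalf]
  congr 2
  ext x
  cases b <;> simp

theorem bitHalf_not_eq_empty {n : ℕ} {b : Bool} {S e : Finset ℕ} (h : e ⊆ bitHalf n b S) :
    bitHalf n (!b) e = ∅ := by
  refine filter_eq_empty_iff.2 fun x hx => ?_
  have := (mem_filter.1 (h hx)).2
  simp [this]

theorem one_half_empty {n : ℕ} {b : Bool} {S e : Finset ℕ} (h : e ⊆ bitHalf n b S) :
    bitHalf n false e = ∅ ∨ bitHalf n true e = ∅ := by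
  have := bitHalf_not_eq_empty h
  cases b
  · exact Or.inr this
  · exact Or.inl this

theorem branchShape_of_subset {n : ℕ} {b : Bool} {S e : Finset ℕ} (h : e ⊆ bitHalf n b S) :
    branchShape (n + 1) e = branchShape n e := by
  rw [branchShape, if_pos (one_half_empty h)]

theorem branchLevels_of_subset {n : ℕ} {b : Bool} {S e : Finset ℕ} (h : e ⊆ bitHalf n b S) :
    branchLevels (n + 1) e = branchLevels n e := by
  rw [branchLevels, if_pos (one_half_empty h)]

theorem bitHalf_union {n : ℕ} {b : Bool} {S e f : Finset ℕ} (he : e ⊆ bitHalf n b S)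
    (hf : f ⊆ bitHalf n (!b) S) : bitHalf n b (e ∪ f) = e := by
  ext x
  simp only [bitHalf, mem_filter, mem_union]
  constructor
  · rintro ⟨h | h, hx⟩
    · exact h
    · have := (mem_filter.1 (hf h)).2
      simp [hx] at this
  · exact fun h => ⟨Or.inl h, (mem_filter.1 (he h)).2⟩

theorem branch_union {n : ℕ} {S e f : Finset ℕ} (he : e ⊆ bitHalf n false S)
    (hf : f ⊆ bitHalf n true S) (hne : e.Nonempty) (hnf : f.Nonempty) :
    branchShape (n + 1) (e ∪ f) = node () (branchShape n e) (branchShape n f) ∧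
      branchLevels (n + 1) (e ∪ f) = insert n (branchLevels n e ∪ branchLevels n f) := by
  have h1 : bitHalf n false (e ∪ f) = e := bitHalf_union he hf
  have h2 : bitHalf n true (e ∪ f) = f := by
    rw [union_comm]
    exact bitHalf_union (b := true) hf he
  simp [branchShape, branchLevels, h1, h2, hne.ne_empty, hnf.ne_empty]

theorem card_union_bitHalf {n : ℕ} {b : Bool} {S e f : Finset ℕ} (he : e ⊆ bitHalf n b S)
    (hf : f ⊆ bitHalf n (!b) S) : (e ∪ f).card = e.card + f.card := by
  refine card_union_of_disjoint (disjoint_left.2 fun x hx hx' => ?_)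
  have h1 := (mem_filter.1 (he hx)).2
  have h2 := (mem_filter.1 (hf hx')).2
  simp [h1] at h2

theorem branch_singleton (n x : ℕ) :
    branchShape n {x} = nil ∧ branchLevels n {x} = ∅ := by
  induction n with
  | zero => exact ⟨rfl, rfl⟩
  | succ n ih =>
    have : ({x} : Finset ℕ) ⊆ bitHalf n (x.testBit n) {x} := by simp [bitHalf]
    rw [branchShape_of_subset this, branchLevels_of_subset this]
    exact ih

theorem hasComb_empty (b : Bool) (n : ℕ) {S : Finset ℕ} (hS : S.Nonempty) :
    HasComb b n S ∅ := by
  obtain ⟨x, hx⟩ := hS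
  intro K hK
  obtain rfl := subset_empty.1 hK
  exact ⟨{x}, by simpa using hx, by simp, (branch_singleton n x).1, (branch_singleton n x).2⟩

theorem HasComb.lift {b c : Bool} {n : ℕ} {S L : Finset ℕ} (h : HasComb b n (bitHalf n c S) L) :
    HasComb b (n + 1) S L := by
  intro K hK
  obtain ⟨e, he, hcard, hs, hl⟩ := h K hK
  exact ⟨e, he.trans (bitHalf_subset _ _ _), hcard, (branchShape_of_subset he).trans hs,
    (branchLevels_of_subset he).trans hl⟩

/-- One point of the opposite half, joined to a comb in half `b`, adds a root branching at level
`n`. -/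
theorem HasComb.extend {b : Bool} {n : ℕ} {S L : Finset ℕ} (h : HasComb b n (bitHalf n b S) L)
    (hS : (bitHalf n (!b) S).Nonempty) : HasComb b (n + 1) S (insert n L) := by
  intro K hK
  by_cases hn : n ∈ K
  · obtain ⟨e, he, hcard, hs, hl⟩ := h (K.erase n) (by rwa [← subset_insert_iff])
    have hcK : (K.erase n).card + 1 = K.card := card_erase_add_one hn
    obtain ⟨x, hx⟩ := hS
    have hxs : ({x} : Finset ℕ) ⊆ bitHalf n (!b) S := by simpa using hx
    have hne : e.Nonempty := card_pos.1 (by omega)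
    have hsub : e ∪ {x} ⊆ S :=
      union_subset (he.trans (bitHalf_subset _ _ _)) (hxs.trans (bitHalf_subset _ _ _))
    refine ⟨e ∪ {x}, hsub, by rw [card_union_bitHalf he hxs, hcard, card_singleton]; omega, ?_⟩
    rw [← hcK]
    cases b
    · obtain ⟨h1, h2⟩ := branch_union he hxs hne (singleton_nonempty x)
      rw [h1, h2, hs, hl, (branch_singleton n x).1, (branch_singleton n x).2]
      simp [combTree, insert_erase hn]
    · rw [union_comm]
      obtain ⟨h1, h2⟩ := branch_union hxs he (singleton_nonempty x) hne
      rw [h1, h2, hs, hl, (branch_singleton n x).1, (branch_singleton n x).2]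
      simp [combTree, insert_erase hn]
  · exact h.lift K ((subset_insert_iff_of_notMem hn).1 hK)

theorem hasAllShapes_zero (n : ℕ) {S : Finset ℕ} (hS : S.Nonempty) : HasAllShapes n 0 S := by
  obtain ⟨x, hx⟩ := hS
  intro τ hτ
  cases τ with
  | nil => exact ⟨{x}, by simpa using hx, by simp [numNodes], (branch_singleton n x).1⟩
  | node _ l r => simp [height] at hτ

theorem HasAllShapes.lift {c : Bool} {n d : ℕ} {S : Finset ℕ}
    (h : HasAllShapes n d (bitHalf n c S)) : HasAllShapes (n + 1) d S := by
  intro τ hτ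
  obtain ⟨e, he, hcard, hs⟩ := h τ hτ
  exact ⟨e, he.trans (bitHalf_subset _ _ _), hcard, (branchShape_of_subset he).trans hs⟩

theorem HasAllShapes.join {n d : ℕ} {S : Finset ℕ} (h₀ : HasAllShapes n d (bitHalf n false S))
    (h₁ : HasAllShapes n d (bitHalf n true S)) : HasAllShapes (n + 1) (d + 1) S := by
  intro τ hτ
  cases τ with
  | nil =>
    obtain ⟨e, he, hcard, hs⟩ := h₀ nil (by simp [height])
    exact ⟨e, he.trans (bitHalf_subset _ _ _), hcard, (branchShape_of_subset he).trans hs⟩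
  | node u l r =>
    simp only [height, add_le_add_iff_right, max_le_iff] at hτ
    obtain ⟨e, he, hce, hse⟩ := h₀ l hτ.1
    obtain ⟨f, hf, hcf, hsf⟩ := h₁ r hτ.2
    refine ⟨e ∪ f, union_subset (he.trans (bitHalf_subset _ _ _))
      (hf.trans (bitHalf_subset _ _ _)), ?_, ?_⟩
    · rw [card_union_bitHalf he hf, hce, hcf, numNodes]
      omega
    · rw [(branch_union he hf (card_pos.1 (by omega)) (card_pos.1 (by omega))).1, hse, hsf]

/-- The recursion behind the bound `(a + b) ^ d`: either one half is large and a comb parameter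
drops, or both halves are fairly large and the depth drops. -/
theorem pow_pred_add_le {s d : ℕ} (hs : 1 ≤ s) :
    (s - 1) ^ (d + 1) + (s - 1) ^ d ≤ s ^ (d + 1) := by
  obtain ⟨r, rfl⟩ := Nat.exists_eq_add_of_le' hs
  calc (r + 1 - 1) ^ (d + 1) + (r + 1 - 1) ^ d = r ^ d * (r + 1) := by simp; ring
    _ ≤ (r + 1) ^ d * (r + 1) := by gcongr; omega
    _ = _ := (pow_succ _ _).symm

/-- A large set of numbers spans a long comb descending to the left, or a long comb descending to
the right, or every binary tree of small height. -/
theorem exists_comb_or_hasAllShapes (n : ℕ) : ∀ (S : Finset ℕ) (a b d : ℕ),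
    (∀ x ∈ S, ∀ y ∈ S, (∀ i < n, x.testBit i = y.testBit i) → x = y) → (a + b) ^ d < S.card →
    (∃ L ⊆ range n, L.card = a ∧ HasComb false n S L) ∨
    (∃ L ⊆ range n, L.card = b ∧ HasComb true n S L) ∨ HasAllShapes n d S := by
  induction n with
  | zero =>
    intro S a b d hS hcard
    have hne : S.Nonempty := card_pos.1 (by omega)
    have h1 : S.card ≤ 1 := card_le_one.2 fun x hx y hy => hS x hx y hy (by simp)
    have h0 : (a + b) ^ d = 0 := by omega
    have ha : a = 0 := by have := eq_zero_of_pow_eq_zero h0; omega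
    exact Or.inl ⟨∅, by simp, by simp [ha], hasComb_empty _ _ hne⟩
  | succ n ih =>
    intro S a b d hS hcard
    have hne : S.Nonempty := card_pos.1 (by omega)
    have hinj : ∀ c : Bool, ∀ x ∈ bitHalf n c S, ∀ y ∈ bitHalf n c S,
        (∀ i < n, x.testBit i = y.testBit i) → x = y := by
      intro c x hx y hy h
      obtain ⟨hx, hxc⟩ := mem_filter.1 hx
      obtain ⟨hy, hyc⟩ := mem_filter.1 hy
      refine hS x hx y hy fun i hi => ?_
      rcases Nat.lt_succ_iff_lt_or_eq.1 hi with h' | rfl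
      · exact h i h'
      · rw [hxc, hyc]
    have hmono : range n ⊆ range (n + 1) := range_subset_range.2 (Nat.le_succ n)
    have hins : ∀ L ⊆ range n, insert n L ⊆ range (n + 1) ∧ (insert n L).card = L.card + 1 :=
      fun L hL => ⟨insert_subset (by simp) (hL.trans hmono),
        card_insert_of_notMem fun h => by simpa using hL h⟩
    rcases Nat.eq_zero_or_pos a with rfl | ha
    · exact Or.inl ⟨∅, by simp, by simp, hasComb_empty _ _ hne⟩
    rcases Nat.eq_zero_or_pos b with rfl | hb
    · exact Or.inr (Or.inl ⟨∅, by simp, by simp, hasComb_empty _ _ hne⟩)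
    cases d with
    | zero => exact Or.inr (Or.inr (hasAllShapes_zero _ hne))
    | succ d =>
    have hsum : (bitHalf n false S).card + (bitHalf n true S).card = S.card :=
      card_bitHalf_add n false S
    rcases (bitHalf n true S).eq_empty_or_nonempty with h1 | h1
    · rw [h1, card_empty, add_zero] at hsum
      rcases ih (bitHalf n false S) a b (d + 1) (hinj _) (by omega) with
        ⟨L, hL, hLc, h⟩ | ⟨L, hL, hLc, h⟩ | h
      · exact Or.inl ⟨L, hL.trans hmono, hLc, h.lift⟩
      · exact Or.inr (Or.inl ⟨L, hL.trans hmono, hLc, h.lift⟩)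
      · exact Or.inr (Or.inr h.lift)
    rcases (bitHalf n false S).eq_empty_or_nonempty with h0 | h0
    · rw [h0, card_empty, zero_add] at hsum
      rcases ih (bitHalf n true S) a b (d + 1) (hinj _) (by omega) with
        ⟨L, hL, hLc, h⟩ | ⟨L, hL, hLc, h⟩ | h
      · exact Or.inl ⟨L, hL.trans hmono, hLc, h.lift⟩
      · exact Or.inr (Or.inl ⟨L, hL.trans hmono, hLc, h.lift⟩)
      · exact Or.inr (Or.inr h.lift)
    have left : ∀ m, (a + b - 1) ^ m < (bitHalf n false S).card →
        (∃ L ⊆ range (n + 1), L.card = a ∧ HasComb false (n + 1) S L) ∨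
        (∃ L ⊆ range (n + 1), L.card = b ∧ HasComb true (n + 1) S L) ∨
        HasAllShapes n m (bitHalf n false S) := by
      intro m hm
      rcases ih _ (a - 1) b m (hinj false)
        (by rwa [show a - 1 + b = a + b - 1 by omega]) with
        ⟨L, hL, hLc, h⟩ | ⟨L, hL, hLc, h⟩ | h
      · exact Or.inl ⟨_, (hins L hL).1, by rw [(hins L hL).2]; omega, h.extend h1⟩
      · exact Or.inr (Or.inl ⟨L, hL.trans hmono, hLc, h.lift⟩)
      · exact Or.inr (Or.inr h)
    have right : ∀ m, (a + b - 1) ^ m < (bitHalf n true S).card →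
        (∃ L ⊆ range (n + 1), L.card = a ∧ HasComb false (n + 1) S L) ∨
        (∃ L ⊆ range (n + 1), L.card = b ∧ HasComb true (n + 1) S L) ∨
        HasAllShapes n m (bitHalf n true S) := by
      intro m hm
      rcases ih _ a (b - 1) m (hinj true)
        (by rwa [show a + (b - 1) = a + b - 1 by omega]) with
        ⟨L, hL, hLc, h⟩ | ⟨L, hL, hLc, h⟩ | h
      · exact Or.inl ⟨L, hL.trans hmono, hLc, h.lift⟩
      · exact Or.inr (Or.inl ⟨_, (hins L hL).1, by rw [(hins L hL).2]; omega, h.extend h0⟩)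
      · exact Or.inr (Or.inr h)
    have hpow := pow_pred_add_le (s := a + b) (d := d) (by omega)
    by_cases hl : (a + b - 1) ^ (d + 1) < (bitHalf n false S).card
    · rcases left _ hl with h | h | h
      · exact Or.inl h
      · exact Or.inr (Or.inl h)
      · exact Or.inr (Or.inr h.lift)
    by_cases hr : (a + b - 1) ^ (d + 1) < (bitHalf n true S).card
    · rcases right _ hr with h | h | h
      · exact Or.inl h
      · exact Or.inr (Or.inl h)
      · exact Or.inr (Or.inr h.lift)
    -- Neither half exceeds `(a + b - 1) ^ (d + 1)`, so by `hpow` each exceeds `(a + b - 1) ^ d`.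
    rcases left d (by omega) with h | h | hl'
    · exact Or.inl h
    · exact Or.inr (Or.inl h)
    rcases right d (by omega) with h | h | hr'
    · exact Or.inl h
    · exact Or.inr (Or.inl h)
    exact Or.inr (Or.inr (hl'.join hr'))

/-! ### The stepped-up colouring -/

theorem combTree_numNodes (b : Bool) (k : ℕ) : (combTree b k).numNodes = k := by
  induction k with
  | zero => rfl
  | succ k ih => cases b <;> simp [combTree, numNodes] at ih ⊢ <;> omega

theorem combTree_false_ne_true {k : ℕ} (hk : 2 ≤ k) : combTree true k ≠ combTree false k := by
  obtain ⟨k, rfl⟩ := Nat.exists_eq_add_of_le' hk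
  simp [combTree]

/-- The trees with `k` internal nodes that are not combs. -/
def nonCombs (k : ℕ) : Finset (BinaryTree Unit) :=
  ((treesOfNumNodesEq k).erase (combTree false k)).erase (combTree true k)

theorem catalan_le_card_nonCombs (k : ℕ) : catalan k - 2 ≤ (nonCombs k).card := by
  have h1 := pred_card_le_card_erase (s := treesOfNumNodesEq k) (a := combTree false k)
  have h2 := pred_card_le_card_erase (s := (treesOfNumNodesEq k).erase (combTree false k))
    (a := combTree true k)
  rw [treesOfNumNodesEq_card_eq_catalan] at h1
  rw [nonCombs]
  omega

theorem exists_image_eq_range {α : Type*} [DecidableEq α] {s : Finset α} {m : ℕ} (hm : 0 < m)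
    (hs : m ≤ s.card) : ∃ f : α → ℕ, (∀ x, f x < m) ∧ range m ⊆ s.image f := by
  -- Reducing mod `m` keeps all values below `m` even when `s` has more than `m` elements.
  refine ⟨fun x => if h : x ∈ s then (s.equivFin ⟨x, h⟩ : ℕ) % m else 0, fun x => ?_, fun i hi => ?_⟩
  · dsimp only
    split_ifs
    · exact Nat.mod_lt _ hm
    · exact hm
  · have him := mem_range.1 hi
    set y := s.equivFin.symm ⟨i, him.trans_le hs⟩ with hy
    exact mem_image.2 ⟨y, y.2, by simp [hy, Nat.mod_eq_of_lt him]⟩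

/-- The colouring that uses `g false` and `g true` on the branching levels of combs, and `f` on the
shapes of the other sets. -/
def stepUp (n k : ℕ) (g : Bool → Finset ℕ → ℕ) (f : BinaryTree Unit → ℕ) (e : Finset ℕ) : ℕ :=
  if branchShape n e = combTree false k then g false (branchLevels n e)
  else if branchShape n e = combTree true k then g true (branchLevels n e)
  else f (branchShape n e)

theorem stepUp_comb {n k : ℕ} (hk : 2 ≤ k) (g : Bool → Finset ℕ → ℕ) (f : BinaryTree Unit → ℕ)
    (b : Bool) {e : Finset ℕ} (he : branchShape n e = combTree b k) :
    stepUp n k g f e = g b (branchLevels n e) := by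
  cases b
  · simp [stepUp, he]
  · simp [stepUp, he, combTree_false_ne_true hk]

theorem image_stepUp_of_hasComb {n k : ℕ} (hk : 2 ≤ k) (g : Bool → Finset ℕ → ℕ)
    (f : BinaryTree Unit → ℕ) {b : Bool} {S L : Finset ℕ} (h : HasComb b n S L) :
    (powersetCard k L).image (g b) ⊆ (powersetCard (k + 1) S).image (stepUp n k g f) := by
  intro c hc
  obtain ⟨K, hK, rfl⟩ := mem_image.1 hc
  obtain ⟨hKL, hKc⟩ := mem_powersetCard.1 hK
  obtain ⟨e, he, hcard, hs, hl⟩ := h K hKL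
  rw [hKc] at hcard hs
  exact mem_image.2 ⟨e, mem_powersetCard.2 ⟨he, hcard⟩, by rw [stepUp_comb hk g f b hs, hl]⟩

theorem image_stepUp_of_hasAllShapes {n k : ℕ} (g : Bool → Finset ℕ → ℕ)
    (f : BinaryTree Unit → ℕ) {S : Finset ℕ} (h : HasAllShapes n k S) :
    (nonCombs k).image f ⊆ (powersetCard (k + 1) S).image (stepUp n k g f) := by
  intro c hc
  obtain ⟨τ, hτ, rfl⟩ := mem_image.1 hc
  simp only [nonCombs, mem_erase, mem_treesOfNumNodesEq] at hτ
  obtain ⟨e, he, hcard, hs⟩ := h τ (τ.height_le_numNodes.trans hτ.2.2.le)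
  exact mem_image.2 ⟨e, mem_powersetCard.2 ⟨he, by rw [hcard, hτ.2.2]⟩,
    by simp [stepUp, hs, hτ.1, hτ.2.1]⟩

theorem exists_stepUp_of_hasAllShapes {n k : ℕ} (hk : 2 ≤ k) (g : Bool → Finset ℕ → ℕ)
    (f : BinaryTree Unit → ℕ) {S : Finset ℕ} (h : HasAllShapes n k S) (b : Bool) :
    ∃ K, g b K ∈ (powersetCard (k + 1) S).image (stepUp n k g f) := by
  have hn := combTree_numNodes b k
  obtain ⟨e, he, hcard, hs⟩ := h (combTree b k) ((height_le_numNodes _).trans hn.le)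
  exact ⟨branchLevels n e, mem_image.2 ⟨e, mem_powersetCard.2 ⟨he, by rw [hcard, hn]⟩,
    stepUp_comb hk g f b hs⟩⟩

theorem testBit_injOn_range (n : ℕ) {S : Finset ℕ} (hS : S ⊆ range (2 ^ n)) :
    ∀ x ∈ S, ∀ y ∈ S, (∀ i < n, x.testBit i = y.testBit i) → x = y := by
  intro x hx y hy h
  refine Nat.eq_of_testBit_eq fun i => ?_
  rcases lt_or_ge i n with hi | hi
  · exact h i hi
  · have hpow : 2 ^ n ≤ 2 ^ i := Nat.pow_le_pow_right (by norm_num) hi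
    rw [Nat.testBit_lt_two_pow ((mem_range.1 (hS hx)).trans_le hpow),
      Nat.testBit_lt_two_pow ((mem_range.1 (hS hy)).trans_le hpow)]

theorem two_pow_lt_ramseyNumber_same_colours {k t q p n T : ℕ} (hk : 2 ≤ k) (hq : 0 < q)
    (hp : 2 ≤ p) (hpq : p ≤ q) (hpk : p ≤ (nonCombs k).card) (hT : (t + t) ^ k < T)
    (hn : n < ramseyNumber k t q p) : 2 ^ n < ramseyNumber (k + 1) T q p := by
  obtain ⟨χ, hχ, hspan⟩ := exists_colouring_of_lt_ramseyNumber hq hn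
  obtain ⟨f, hf, hfim⟩ := exists_image_eq_range (by omega) hpk
  refine lt_ramseyNumber_of_colouring hq hp (stepUp n k (fun _ => χ) f) (fun e => ?_)
    fun S hS hSc => ?_
  · rw [stepUp]
    split_ifs
    · exact hχ _
    · exact hχ _
    · exact (hf _).trans_le hpq
  · have comb : ∀ b : Bool, ∀ L ⊆ range n, L.card = t → HasComb b n S L →
        p ≤ ((powersetCard (k + 1) S).image (stepUp n k (fun _ => χ) f)).card :=
      fun b L hL hLc h => (hspan L hL hLc).trans
        (card_le_card (image_stepUp_of_hasComb hk (fun _ => χ) f h))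
    rcases exists_comb_or_hasAllShapes n S t t k (testBit_injOn_range n hS) (by omega) with
      ⟨L, hL, hLc, h⟩ | ⟨L, hL, hLc, h⟩ | h
    · exact comb false L hL hLc h
    · exact comb true L hL hLc h
    · simpa using card_le_card (hfim.trans (image_stepUp_of_hasAllShapes (fun _ => χ) f h))

theorem two_pow_lt_ramseyNumber_more_colours {k t q p n T : ℕ} (hk : 2 ≤ k) (hq : 0 < q)
    (hp : 3 ≤ p) (hpk : p - 2 ≤ (nonCombs k).card) (hT : (t + t) ^ k < T)
    (hn : n < ramseyNumber k t q p) :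
    2 ^ n < ramseyNumber (k + 1) T (2 * q + p) p := by
  obtain ⟨χ, hχ, hspan⟩ := exists_colouring_of_lt_ramseyNumber hq hn
  obtain ⟨f, hf, hfim⟩ := exists_image_eq_range (by omega) hpk
  -- Palettes: `[0, q)` for left combs, `[q, 2q)` for right combs, and from `2q` on for the other
  -- shapes.
  set g : Bool → Finset ℕ → ℕ := fun b e => (if b then q else 0) + χ e with hg
  set f' : BinaryTree Unit → ℕ := fun τ => 2 * q + f τ with hf'
  refine lt_ramseyNumber_of_colouring (by omega) (by omega) (stepUp n k g f') (fun e => ?_)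
    fun S hS hSc => ?_
  · have h1 := hχ (branchLevels n e)
    have h2 := hf (branchShape n e)
    simp only [stepUp, hg, hf', Bool.false_eq_true, if_false, if_true]
    split_ifs <;> omega
  · have comb : ∀ b : Bool, ∀ L ⊆ range n, L.card = t → HasComb b n S L →
        p ≤ ((powersetCard (k + 1) S).image (stepUp n k g f')).card := by
      intro b L hL hLc h
      refine le_trans ?_ (card_le_card (image_stepUp_of_hasComb hk g f' h))
      have : (powersetCard k L).image (g b) =
          ((powersetCard k L).image χ).image fun i => (if b then q else 0) + i := by
        rw [image_image]; rfl
      rw [this, card_image_of_injective _ (add_right_injective _)]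
      exact hspan L hL hLc
    rcases exists_comb_or_hasAllShapes n S t t k (testBit_injOn_range n hS) (by omega) with
      ⟨L, hL, hLc, h⟩ | ⟨L, hL, hLc, h⟩ | h
    · exact comb false L hL hLc h
    · exact comb true L hL hLc h
    · obtain ⟨K, hK⟩ := exists_stepUp_of_hasAllShapes hk g f' h false
      obtain ⟨K', hK'⟩ := exists_stepUp_of_hasAllShapes hk g f' h true
      have h1 := hχ K
      have h2 := hχ K'
      have hsub : insert (g false K) (insert (g true K') ((range (p - 2)).image (2 * q + ·))) ⊆
          (powersetCard (k + 1) S).image (stepUp n k g f') := by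
        refine insert_subset hK (insert_subset hK' ?_)
        refine subset_trans ?_ (image_stepUp_of_hasAllShapes g f' h)
        rw [show (nonCombs k).image f' = ((nonCombs k).image f).image (2 * q + ·) by
          rw [image_image]; rfl]
        exact image_subset_image hfim
      have hcard := card_le_card hsub
      have hg₀ : g false K = χ K := by simp [hg]
      have hg₁ : g true K' = q + χ K' := by simp [hg]
      have hK₁ : g true K' ∉ (range (p - 2)).image (2 * q + ·) := by
        intro hmem
        obtain ⟨i, -, hi⟩ := mem_image.1 hmem
        omega
      have hK₀ : g false K ∉ insert (g true K') ((range (p - 2)).image (2 * q + ·)) := by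
        intro hmem
        rcases mem_insert.1 hmem with h | h
        · omega
        · obtain ⟨i, -, hi⟩ := mem_image.1 h
          omega
      rw [card_insert_of_notMem hK₀, card_insert_of_notMem hK₁,
        card_image_of_injective _ (add_right_injective _), card_range] at hcard
      omega

theorem mainTheorem1 (k q p : ℕ) (hk : 3 ≤ k) (hq : 3 ≤ q) (hp : 3 ≤ p) (hpk : p ≤ catalan k) :
    ∃ c t₀ : ℕ, 1 ≤ c ∧ ∀ t : ℕ, t₀ < t →
      (4 ≤ p → p - 2 ≤ q →
        2 ^ (ramseyNumber k t q (p - 2) - 1) < ramseyNumber (k + 1) (t ^ c) q (p - 2)) ∧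
      2 ^ (ramseyNumber k t q p - 1) < ramseyNumber (k + 1) (t ^ c) (2 * q + p) p := by
  -- `t > 2 ^ k` is exactly what makes `(2t) ^ k < t ^ (k + 1)`.
  refine ⟨k + 1, 2 ^ k, by omega, fun t ht => ?_⟩
  have ht0 : 0 < t := (Nat.zero_le _).trans_lt ht
  have hT : (t + t) ^ k < t ^ (k + 1) := by
    rw [← two_mul, mul_pow, pow_succ, mul_comm]
    exact Nat.mul_lt_mul_of_pos_left ht (pow_pos ht0 k)
  have hcat := catalan_le_card_nonCombs k
  have hpos : ∀ p', 2 ≤ p' → 0 < ramseyNumber k t q p' := by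
    intro p' hp'
    by_contra! h0
    have h := forcesFewColours_ramseyNumber (k := k) (t := t) (q := q) (by omega) hp'
    obtain ⟨T, hTr, hTt, -⟩ := (forcesFewColours_iff (by omega)).1 h (fun _ => 0) fun _ => by omega
    have := card_le_card hTr
    rw [card_range] at this
    omega
  refine ⟨fun h4 hpq => ?_, ?_⟩
  · exact two_pow_lt_ramseyNumber_same_colours (by omega) (by omega) (by omega) hpq (by omega) hT
      (Nat.sub_lt (hpos _ (by omega)) one_pos)
  · exact two_pow_lt_ramseyNumber_more_colours (by omega) (by omega) hp (by omega) hT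
      (Nat.sub_lt (hpos _ (by omega)) one_pos)
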